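/- Let $\mathcal{E}$ be an elementary topos (a category with finite limits, exponentials and a subobject classifier $\mathrm{true}\colon \mathbf 1\to\Omega$). A local state classifier of $\mathcal{E}$ is a colimit $\{\xi_X\colon X\to\Xi\}_{X\in\mathcal{E}}$ of the inclusion functor $\mathrm{Mono}(\mathcal{E})\to\mathcal{E}$, where $\mathrm{Mono}(\mathcal{E})$ is the (possibly large) subcategory of all objects and all monomorphisms; every Grothendieck topos has one. Such a $\Xi$ is an internal (bounded meet-)semilattice, with $\top=\xi_{\mathbf 1}\colon\mathbf 1\to\Xi$ and with $\wedge\colon\Xi\times\Xi\to\Xi$ the unique morphism satisfying $\wedge\circ(\xi_X\times\xi_Y)=\xi_{X\times Y}$ for all $X,Y$. The object $\Omega$ is an internal semilattice with $\top=\mathrm{true}$ and with $\wedge$ the characteristic map of $\langle\mathrm{true},\mathrm{true}\rangle\colon\mathbf 1\to\Omega\times\Omega$. An internal filter of $\Xi$ is a subobject $F\rightarrowtail\Xi$ that is (internally) closed under $\top$, closed under $\wedge$ and upward closed. A hyperconnected quotient of $\mathcal{E}$ is a geometric morphism $f\colon\mathcal{E}\to\mathcal{F}$ to a topos $\mathcal{F}$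 such that $f^*$ is full and faithful and its essential image is closed under subobjects in $\mathcal{E}$; two of them, $f\colon\mathcal{E}\to\mathcal{F}$ and $f'\colon\mathcal{E}\to\mathcal{F}'$, are identified if $e\circ f\cong f'$ for some equivalence $e\colon\mathcal{F}\to\mathcal{F}'$. **Theorem.** Let $\mathcal{E}$ be an elementary topos with a local state classifier $\{\xi_X\colon X\to\Xi\}$ (for example, an arbitrary Grothendieck topos). Then the following correspond bijectively: 1. hyperconnected quotients of $\mathcal{E}$ (up to the identification above); 2. internal filters of $\Xi$; 3. internal semilattice homomorphisms $\Xi\to\Omega$. Explicitly, a filter $F\rightarrowtail\Xi$ corresponds to its characteristic map $\chi_F\colon\Xi\to\Omega$, and a hyperconnected quotient $f$ corresponds to the filter $F$ such that, for every object $X$, $X$ lies in the essential image of $f^*$ if and only if $\xi_X$ factors through $F$, and such that the counit $f^*f_*X\to X$ is the pullback of $F\rightarrowtail\Xi$ along $\xi_X$. -/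

import Mathlib

open CategoryTheory Limits MonoidalCategory CartesianMonoidalCategory

universe w v u v₁ u₁ v₂ u₂

namespace LSC

/-! ### Toposes -/

/-- An (elementary) topos: a cartesian closed category with finite limits and a subobject
classifier. Cartesian closedness says that each functor `X × -` has a right adjoint. -/
class ElementaryTopos (C : Type u) [Category.{v} C] : Prop
    extends HasFiniteLimits C, HasSubobjectClassifier C where
  exponentiable : ∀ X : C, (prod.functor.obj X).IsLeftAdjoint

/-- A Grothendieck topos: a category equivalent to the category of sheaves of sets on a small
site. -/
def IsGrothendieckTopos (C : Type u) [Category.{v} C] : Prop :=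
  ∃ (D : Type w) (_ : SmallCategory D) (J : GrothendieckTopology D),
    Nonempty (C ≌ Sheaf J (Type w))

/-- A geometric morphism `f : C → D`: an adjunction `f^* ⊣ f_*` with `f_* : C ⥤ D` and with
`f^* : D ⥤ C` left exact. -/
structure GeometricMorphism (C : Type u₁) [Category.{v₁} C] (D : Type u₂) [Category.{v₂} D] where
  directImage : C ⥤ D
  inverseImage : D ⥤ C
  adj : inverseImage ⊣ directImage
  leftExact : PreservesFiniteLimits inverseImage

/-- A geometric morphism `f` is hyperconnected if `f^*` is full and faithful and its essential image
is closed under subobjects. -/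
structure GeometricMorphism.IsHyperconnected {C : Type u₁} [Category.{v₁} C] {D : Type u₂}
    [Category.{v₂} D] (f : GeometricMorphism C D) : Prop where
  full : f.inverseImage.Full
  faithful : f.inverseImage.Faithful
  closed_subobjects : ∀ {X Y : C} (m : X ⟶ Y) [Mono m],
    f.inverseImage.essImage Y → f.inverseImage.essImage X

/-- A hyperconnected geometric morphism from `C` to some topos. -/
structure HyperconnectedFrom (C : Type u) [Category.{v} C] where
  target : Type u
  [category : Category.{v} target]
  [topos : ElementaryTopos target]
  morphism : GeometricMorphism C target
  hyperconnected : morphism.IsHyperconnected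

attribute [instance] HyperconnectedFrom.category HyperconnectedFrom.topos

namespace HyperconnectedFrom

variable {C : Type u} [Category.{v} C]

/-- The inverse image functor of the geometric morphism. -/
abbrev inverseImage (Q : HyperconnectedFrom C) : Q.target ⥤ C := Q.morphism.inverseImage

/-- The counit `f^* f_* X ⟶ X`. -/
abbrev counit (Q : HyperconnectedFrom C) (X : C) :
    Q.inverseImage.obj (Q.morphism.directImage.obj X) ⟶ X := Q.morphism.adj.counit.app X

/-- Two hyperconnected geometric morphisms `f : C → D` and `f' : C → D'` are identified if there is
an equivalence `e : D ≌ D'` such that `e ∘ f` and `f'` are isomorphic geometric morphisms. The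
inverse image functor of `e ∘ f` is `e⁻¹ ⋙ f^*`, and an isomorphism of geometric morphisms is a
natural isomorphism of inverse image functors. -/
def Equivalent (Q Q' : HyperconnectedFrom C) : Prop :=
  ∃ e : Q.target ≌ Q'.target, Nonempty (e.inverse ⋙ Q.inverseImage ≅ Q'.inverseImage)

theorem equivalent_equivalence : Equivalence (Equivalent (C := C)) where
  refl Q := ⟨CategoryTheory.Equivalence.refl, ⟨Functor.leftUnitor _⟩⟩
  symm := by
    rintro Q Q' ⟨e, ⟨i⟩⟩
    exact ⟨e.symm, ⟨Functor.isoWhiskerLeft e.functor i.symm ≪≫ (Functor.associator _ _ _).symm ≪≫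
      Functor.isoWhiskerRight e.unitIso.symm _ ≪≫ Functor.leftUnitor _⟩⟩
  trans := by
    rintro Q Q' Q'' ⟨e, ⟨i⟩⟩ ⟨e', ⟨i'⟩⟩
    exact ⟨e.trans e', ⟨Functor.associator _ _ _ ≪≫ Functor.isoWhiskerLeft e'.inverse i ≪≫ i'⟩⟩

instance setoid (C : Type u) [Category.{v} C] : Setoid (HyperconnectedFrom C) where
  r := Equivalent
  iseqv := equivalent_equivalence

end HyperconnectedFrom

/-- The hyperconnected quotients of `C`: hyperconnected geometric morphisms from `C` up to the
standard identification. -/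
def HyperconnectedQuotient (C : Type u) [Category.{v} C] : Type (max (u + 1) (v + 1)) :=
  Quotient (HyperconnectedFrom.setoid C)

/-- The hyperconnected quotient represented by a hyperconnected geometric morphism. -/
def HyperconnectedFrom.toQuotient {C : Type u} [Category.{v} C] (Q : HyperconnectedFrom C) :
    HyperconnectedQuotient C :=
  Quotient.mk _ Q

/-! ### Internal semilattices -/

section Semilattice

variable {C : Type u} [Category.{v} C] [CartesianMonoidalCategory C]

/-- An internal (bounded meet-)semilattice. -/
structure InternalSemilattice (C : Type u) [Category.{v} C] [CartesianMonoidalCategory C] where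
  carrier : C
  top : 𝟙_ C ⟶ carrier
  meet : carrier ⊗ carrier ⟶ carrier
  top_meet : (λ_ carrier).inv ≫ (top ▷ carrier) ≫ meet = 𝟙 carrier
  meet_top : (ρ_ carrier).inv ≫ (carrier ◁ top) ≫ meet = 𝟙 carrier
  meet_assoc : (meet ▷ carrier) ≫ meet =
    (α_ carrier carrier carrier).hom ≫ (carrier ◁ meet) ≫ meet
  meet_comm : lift (snd carrier carrier) (fst carrier carrier) ≫ meet = meet
  meet_idem : lift (𝟙 carrier) (𝟙 carrier) ≫ meet = 𝟙 carrier

/-- Internal semilattice homomorphisms. -/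
@[ext]
structure SemilatticeHom (A B : InternalSemilattice C) where
  hom : A.carrier ⟶ B.carrier
  map_top : A.top ≫ hom = B.top
  map_meet : A.meet ≫ hom = (hom ⊗ₘ hom) ≫ B.meet

/-- Internal filters: subobjects that are closed under `⊤`, closed under `∧`, and upward closed,
i.e. `∀ (a, x) ∈ F × A, a ∧ x = a → (a, x) ∈ F × F`. -/
@[ext]
structure InternalFilter [HasFiniteLimits C] (A : InternalSemilattice C) where
  sub : Subobject A.carrier
  top_closed : ∃ t : 𝟙_ C ⟶ (sub : C), t ≫ sub.arrow = A.top
  meet_closed : ∃ d : (sub : C) ⊗ (sub : C) ⟶ (sub : C),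
    d ≫ sub.arrow = (sub.arrow ⊗ₘ sub.arrow) ≫ A.meet
  upward_closed : ∃ l : equalizer ((sub.arrow ▷ A.carrier) ≫ A.meet)
        (fst (sub : C) A.carrier ≫ sub.arrow) ⟶ (sub : C) ⊗ (sub : C),
    l ≫ ((sub : C) ◁ sub.arrow) =
      equalizer.ι ((sub.arrow ▷ A.carrier) ≫ A.meet) (fst (sub : C) A.carrier ≫ sub.arrow)

end Semilattice

/-! ### The internal semilattice of truth values -/

section Omega

variable {C : Type u} [Category.{v} C] [CartesianMonoidalCategory C] (c : Subobject.Classifier C)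

/-- The global element `true : 1 ⟶ Ω`. -/
def trueElt : 𝟙_ C ⟶ c.Ω := c.χ₀ (𝟙_ C) ≫ c.truth

instance mono_of_unit {X : C} (f : 𝟙_ C ⟶ X) : Mono f :=
  ⟨fun _ _ _ => toUnit_unique _ _⟩

/-- Conjunction: the characteristic map of `⟨true, true⟩ : 1 ⟶ Ω × Ω`. -/
def omegaMeet : c.Ω ⊗ c.Ω ⟶ c.Ω := c.χ (lift (trueElt c) (trueElt c))

theorem χ₀_truth (X : C) : c.χ₀ X ≫ c.truth = toUnit X ≫ trueElt c := by
  rw [trueElt, ← Category.assoc]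
  congr 1
  exact c.isTerminalΩ₀.hom_ext _ _

theorem comp_χ_eq_true_iff {T U X : C} (m : U ⟶ X) [Mono m] (t : T ⟶ X) :
    t ≫ c.χ m = toUnit T ≫ trueElt c ↔ ∃ s : T ⟶ U, s ≫ m = t := by
  constructor
  · intro h
    rw [← χ₀_truth] at h
    exact ⟨(c.isPullback m).lift t (c.χ₀ T) h, (c.isPullback m).lift_fst _ _ _⟩
  · rintro ⟨s, rfl⟩
    rw [Category.assoc, (c.isPullback m).w, χ₀_truth, ← Category.assoc, comp_toUnit]

theorem omega_ext [HasPullbacks C] {X : C} {f g : X ⟶ c.Ω}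
    (h : ∀ (T : C) (t : T ⟶ X),
      t ≫ f = toUnit T ≫ trueElt c ↔ t ≫ g = toUnit T ≫ trueElt c) : f = g := by
  obtain ⟨Z, i, _, rfl⟩ := c.surjective_χ f
  refine (c.uniq i (χ₀' := c.χ₀ Z) ?_).symm
  have hw : i ≫ g = c.χ₀ Z ≫ c.truth := by
    rw [χ₀_truth]
    exact (h _ _).1 ((comp_χ_eq_true_iff c i i).2 ⟨𝟙 _, by simp⟩)
  have hs : ∀ s : PullbackCone g c.truth, s.fst ≫ g = toUnit _ ≫ trueElt c := fun s => by
    rw [s.condition, ← χ₀_truth]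
    congr 1
    exact c.isTerminalΩ₀.hom_ext _ _
  refine ⟨⟨hw⟩, ⟨PullbackCone.IsLimit.mk _
    (fun s => ((comp_χ_eq_true_iff c i s.fst).1 ((h _ _).2 (hs s))).choose) (fun s => ?_)
    (fun s => c.isTerminalΩ₀.hom_ext _ _) (fun s m hm _ => ?_)⟩⟩
  · exact ((comp_χ_eq_true_iff c i s.fst).1 ((h _ _).2 (hs s))).choose_spec
  · rw [← cancel_mono i, hm]
    exact ((comp_χ_eq_true_iff c i s.fst).1 ((h _ _).2 (hs s))).choose_spec.symm

theorem lift_meet_eq_true_iff {T : C} (a b : T ⟶ c.Ω) :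
    lift a b ≫ omegaMeet c = toUnit T ≫ trueElt c ↔
      a = toUnit T ≫ trueElt c ∧ b = toUnit T ≫ trueElt c := by
  rw [omegaMeet, comp_χ_eq_true_iff]
  constructor
  · rintro ⟨s, hs⟩
    have h1 := congrArg (· ≫ fst _ _) hs
    have h2 := congrArg (· ≫ snd _ _) hs
    simp only [comp_lift, lift_fst, lift_snd] at h1 h2
    rw [toUnit_unique (toUnit T) s]
    exact ⟨h1.symm, h2.symm⟩
  · rintro ⟨ha, hb⟩
    exact ⟨toUnit T, by rw [comp_lift, ha, hb]⟩

/-- The subobject classifier as an internal semilattice. -/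
abbrev omegaSemilattice [HasPullbacks C] : InternalSemilattice C where
  carrier := c.Ω
  top := trueElt c
  meet := omegaMeet c
  top_meet := omega_ext c fun T t => by
    have : t ≫ (λ_ c.Ω).inv ≫ (trueElt c ▷ c.Ω) ≫ omegaMeet c =
        lift (toUnit T ≫ trueElt c) t ≫ omegaMeet c := by
      simp only [← Category.assoc]
      congr 1
      ext <;> simp
    rw [this, lift_meet_eq_true_iff]
    simp
  meet_top := omega_ext c fun T t => by
    have : t ≫ (ρ_ c.Ω).inv ≫ (c.Ω ◁ trueElt c) ≫ omegaMeet c =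
        lift t (toUnit T ≫ trueElt c) ≫ omegaMeet c := by
      simp only [← Category.assoc]
      congr 1
      ext <;> simp
    rw [this, lift_meet_eq_true_iff]
    simp
  meet_assoc := omega_ext c fun T t => by
    have h1 : t ≫ (omegaMeet c ▷ c.Ω) ≫ omegaMeet c =
        lift (lift (t ≫ fst _ _ ≫ fst _ _) (t ≫ fst _ _ ≫ snd _ _) ≫ omegaMeet c)
          (t ≫ snd _ _) ≫ omegaMeet c := by
      simp only [← Category.assoc]
      congr 1
      ext
      · simp only [Category.assoc, whiskerRight_fst, lift_fst]
        simp only [← Category.assoc]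
        congr 1
        ext <;> simp
      · simp
    have h2 : t ≫ (α_ c.Ω c.Ω c.Ω).hom ≫ (c.Ω ◁ omegaMeet c) ≫ omegaMeet c =
        lift (t ≫ fst _ _ ≫ fst _ _)
          (lift (t ≫ fst _ _ ≫ snd _ _) (t ≫ snd _ _) ≫ omegaMeet c) ≫ omegaMeet c := by
      simp only [← Category.assoc]
      congr 1
      ext
      · simp
      · simp only [Category.assoc, whiskerLeft_snd, lift_snd]
        simp only [← Category.assoc]
        congr 1
        ext <;> simp
    rw [h1, h2]
    simp only [lift_meet_eq_true_iff, and_assoc]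
  meet_comm := omega_ext c fun T t => by
    have h : t = lift (t ≫ fst _ _) (t ≫ snd _ _) := by simp
    rw [h]
    simp only [comp_lift_assoc, lift_fst, lift_snd, lift_meet_eq_true_iff, and_comm]
  meet_idem := omega_ext c fun T t => by
    rw [comp_lift_assoc, Category.comp_id, lift_meet_eq_true_iff, and_self]

end Omega

section

variable {C : Type u} [Category.{v} C] [CartesianMonoidalCategory C]

theorem mono_whiskerLeft (A : C) {X Y : C} (m : X ⟶ Y) [Mono m] : Mono (A ◁ m) :=
  ⟨fun a b h => by
    have h1 := congrArg (· ≫ fst _ _) h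
    have h2 := congrArg (· ≫ snd _ _) h
    simp only [Category.assoc, whiskerLeft_fst, whiskerLeft_snd] at h1 h2
    ext
    · exact h1
    · rw [← cancel_mono m, Category.assoc, Category.assoc, h2]⟩

theorem mono_whiskerRight (A : C) {X Y : C} (m : X ⟶ Y) [Mono m] : Mono (m ▷ A) :=
  ⟨fun a b h => by
    have h1 := congrArg (· ≫ fst _ _) h
    have h2 := congrArg (· ≫ snd _ _) h
    simp only [Category.assoc, whiskerRight_fst, whiskerRight_snd] at h1 h2
    ext
    · rw [← cancel_mono m, Category.assoc, Category.assoc, h1]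
    · exact h2⟩

end

/-! ### Local state classifiers -/

/-- The inclusion into `C` of the subcategory with the same objects and all monomorphisms. -/
abbrev monoInclusion (C : Type u) [Category.{v} C] :
    WideSubcategory (MorphismProperty.monomorphisms C) ⥤ C :=
  wideSubcategoryInclusion (MorphismProperty.monomorphisms C)

/-- A local state classifier of `C`: a colimit of the inclusion functor of the (possibly large)
category of all monomorphisms. -/
structure LocalStateClassifier (C : Type u) [Category.{v} C] where
  cocone : Cocone (monoInclusion C)
  isColimit : IsColimit cocone

namespace LocalStateClassifier

section

variable {C : Type u} [Category.{v} C] (S : LocalStateClassifier C)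

/-- The object `Ξ`. -/
abbrev Ξ : C := S.cocone.pt

/-- The component `ξ_X : X ⟶ Ξ` of the colimit cocone. -/
def ξ (X : C) : X ⟶ S.Ξ := S.cocone.ι.app ⟨X⟩

theorem ξ_mono {X Y : C} (m : X ⟶ Y) [Mono m] : m ≫ S.ξ Y = S.ξ X :=
  let X' : WideSubcategory (MorphismProperty.monomorphisms C) := ⟨X⟩
  let Y' : WideSubcategory (MorphismProperty.monomorphisms C) := ⟨Y⟩
  let m' : X' ⟶ Y' := ⟨m, MorphismProperty.monomorphisms.infer_property m⟩
  S.cocone.w m'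

theorem ξ_hom_ext {Z : C} {f g : S.Ξ ⟶ Z} (h : ∀ X, S.ξ X ≫ f = S.ξ X ≫ g) : f = g :=
  S.isColimit.hom_ext fun j => h j.obj

end

variable {C : Type u} [Category.{v} C] [CartesianMonoidalCategory C] [ElementaryTopos C]
  (S : LocalStateClassifier C)

instance tensorLeft_isLeftAdjoint (A : C) : (tensorLeft A).IsLeftAdjoint :=
  have := ElementaryTopos.exponentiable A
  Functor.isLeftAdjoint_of_iso (tensorLeftIsoProd A).symm

/-- `A × Ξ` is the colimit of the objects `A × X`. -/
noncomputable def isColimitLeft (A : C) : IsColimit ((tensorLeft A).mapCocone S.cocone) :=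
  isColimitOfPreserves (tensorLeft A) S.isColimit

theorem left_hom_ext {A Z : C} {f g : A ⊗ S.Ξ ⟶ Z}
    (h : ∀ X, (A ◁ S.ξ X) ≫ f = (A ◁ S.ξ X) ≫ g) : f = g :=
  (S.isColimitLeft A).hom_ext fun j => h j.obj

theorem exists_left {A Z : C} (ψ : ∀ X, A ⊗ X ⟶ Z)
    (hψ : ∀ {X Y : C} (m : X ⟶ Y) [Mono m], (A ◁ m) ≫ ψ Y = ψ X) :
    ∃ d : A ⊗ S.Ξ ⟶ Z, ∀ X, (A ◁ S.ξ X) ≫ d = ψ X := by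
  let t : Cocone (monoInclusion C ⋙ tensorLeft A) :=
    { pt := Z
      ι := { app := fun j => ψ j.obj
             naturality := fun j k m => by
               have : Mono m.hom := m.property
               exact (hψ m.hom).trans (Category.comp_id _).symm } }
  exact ⟨(S.isColimitLeft A).desc t, fun X => (S.isColimitLeft A).fac t ⟨X⟩⟩

/-- The symmetry `X × Y ⟶ Y × X`. -/
abbrev swap (X Y : C) : X ⊗ Y ⟶ Y ⊗ X := lift (snd X Y) (fst X Y)

theorem left_hom_ext_of {ι : Sort*} {X : C} {Y : ι → C} (e : ∀ i, Y i ⟶ X)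
    (he : ∀ {Z : C} {f g : X ⟶ Z}, (∀ i, e i ≫ f = e i ≫ g) → f = g) {A Z : C}
    {f g : A ⊗ X ⟶ Z} (h : ∀ i, (A ◁ e i) ≫ f = (A ◁ e i) ≫ g) : f = g := by
  let adj := Adjunction.ofIsLeftAdjoint (tensorLeft A)
  refine (adj.homEquiv X Z).injective (he fun i => ?_)
  rw [← adj.homEquiv_naturality_left, ← adj.homEquiv_naturality_left]
  exact congrArg _ (h i)

theorem right_hom_ext {A Z : C} {f g : S.Ξ ⊗ A ⟶ Z}
    (h : ∀ X, (S.ξ X ▷ A) ≫ f = (S.ξ X ▷ A) ≫ g) : f = g := by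
  have key : swap A S.Ξ ≫ f = swap A S.Ξ ≫ g := S.left_hom_ext fun X => by
    have e : (A ◁ S.ξ X) ≫ swap A S.Ξ = swap A X ≫ (S.ξ X ▷ A) := by ext <;> simp
    rw [← Category.assoc, ← Category.assoc, e, Category.assoc, Category.assoc, h]
  have e : swap S.Ξ A ≫ swap A S.Ξ = 𝟙 _ := by ext <;> simp
  rw [← Category.id_comp f, ← Category.id_comp g, ← e, Category.assoc, Category.assoc, key]

theorem tensor_hom_ext {Z : C} {f g : S.Ξ ⊗ S.Ξ ⟶ Z}
    (h : ∀ X Y, (S.ξ X ⊗ₘ S.ξ Y) ≫ f = (S.ξ X ⊗ₘ S.ξ Y) ≫ g) : f = g :=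
  S.right_hom_ext fun X => S.left_hom_ext fun Y => by
    simpa only [tensorHom_def', Category.assoc] using h X Y

theorem exists_meet :
    ∃ d : S.Ξ ⊗ S.Ξ ⟶ S.Ξ, ∀ X Y, (S.ξ X ⊗ₘ S.ξ Y) ≫ d = S.ξ (X ⊗ Y) := by
  have h1 : ∀ X : C, ∃ d : X ⊗ S.Ξ ⟶ S.Ξ, ∀ Y, (X ◁ S.ξ Y) ≫ d = S.ξ (X ⊗ Y) := fun X =>
    S.exists_left (fun Y => S.ξ (X ⊗ Y)) fun m _ => by
      have := mono_whiskerLeft X m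
      exact S.ξ_mono _
  choose d hd using h1
  obtain ⟨k, hk⟩ := S.exists_left (A := S.Ξ) (fun X => swap S.Ξ X ≫ d X) fun {X Y} m _ => by
    have e : (S.Ξ ◁ m) ≫ swap S.Ξ Y = swap S.Ξ X ≫ (m ▷ S.Ξ) := by ext <;> simp
    rw [← Category.assoc, e, Category.assoc]
    congr 1
    refine S.left_hom_ext fun W => ?_
    have := mono_whiskerRight W m
    rw [hd, ← Category.assoc, whisker_exchange, Category.assoc, hd, S.ξ_mono]
  refine ⟨swap S.Ξ S.Ξ ≫ k, fun X Y => ?_⟩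
  have e : (S.ξ X ⊗ₘ S.ξ Y) ≫ swap S.Ξ S.Ξ = (X ◁ S.ξ Y) ≫ swap X S.Ξ ≫ (S.Ξ ◁ S.ξ X) := by
    ext <;> simp
  have e' : swap X S.Ξ ≫ swap S.Ξ X = 𝟙 _ := by ext <;> simp
  rw [← Category.assoc, e, Category.assoc, Category.assoc, hk, ← Category.assoc (swap X S.Ξ), e',
    Category.id_comp, hd]

/-- The unique `∧ : Ξ × Ξ ⟶ Ξ` with `∧ ∘ (ξ_X × ξ_Y) = ξ_{X × Y}` for all `X` and `Y`. -/
noncomputable def meet : S.Ξ ⊗ S.Ξ ⟶ S.Ξ := S.exists_meet.choose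

theorem tensor₃_hom_ext {Z : C} {f g : (S.Ξ ⊗ S.Ξ) ⊗ S.Ξ ⟶ Z}
    (h : ∀ W X Y, ((S.ξ W ⊗ₘ S.ξ X) ⊗ₘ S.ξ Y) ≫ f = ((S.ξ W ⊗ₘ S.ξ X) ⊗ₘ S.ξ Y) ≫ g) :
    f = g := by
  refine S.left_hom_ext fun Y => ?_
  have key : swap Y (S.Ξ ⊗ S.Ξ) ≫ (_ ◁ S.ξ Y) ≫ f = swap Y (S.Ξ ⊗ S.Ξ) ≫ (_ ◁ S.ξ Y) ≫ g := by
    refine left_hom_ext_of (ι := C × C) (fun p => S.ξ p.1 ⊗ₘ S.ξ p.2)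
      (fun h' => S.tensor_hom_ext fun W X => h' (W, X)) fun p => ?_
    have e : (Y ◁ (S.ξ p.1 ⊗ₘ S.ξ p.2)) ≫ swap Y (S.Ξ ⊗ S.Ξ) ≫ ((S.Ξ ⊗ S.Ξ) ◁ S.ξ Y) =
        swap Y (p.1 ⊗ p.2) ≫ ((S.ξ p.1 ⊗ₘ S.ξ p.2) ⊗ₘ S.ξ Y) := by ext <;> simp
    have e' := congrArg (swap Y (p.1 ⊗ p.2) ≫ ·) (h p.1 p.2 Y)
    simp only [← Category.assoc] at e e' ⊢
    rw [e, e']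
  have e : swap (S.Ξ ⊗ S.Ξ) Y ≫ swap Y (S.Ξ ⊗ S.Ξ) = 𝟙 _ := by ext <;> simp
  have key' := congrArg (swap (S.Ξ ⊗ S.Ξ) Y ≫ ·) key
  simpa only [← Category.assoc, e, Category.id_comp] using key'

theorem ξ_meet (X Y : C) : (S.ξ X ⊗ₘ S.ξ Y) ≫ S.meet = S.ξ (X ⊗ Y) :=
  S.exists_meet.choose_spec X Y

/-- The canonical internal semilattice structure on the local state classifier: `⊤` is `ξ_1`, and
`∧` is determined by `∧ ∘ (ξ_X × ξ_Y) = ξ_{X × Y}`. -/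
noncomputable abbrev semilattice : InternalSemilattice C where
  carrier := S.Ξ
  top := S.ξ (𝟙_ C)
  meet := S.meet
  top_meet := S.ξ_hom_ext fun X => by
    have e : S.ξ X ≫ (λ_ S.Ξ).inv ≫ (S.ξ (𝟙_ C) ▷ S.Ξ) =
        (λ_ X).inv ≫ (S.ξ (𝟙_ C) ⊗ₘ S.ξ X) := by ext <;> simp
    rw [← Category.assoc (λ_ S.Ξ).inv, ← Category.assoc, e, Category.assoc, S.ξ_meet, S.ξ_mono,
      Category.comp_id]
  meet_top := S.ξ_hom_ext fun X => by
    have e : S.ξ X ≫ (ρ_ S.Ξ).inv ≫ (S.Ξ ◁ S.ξ (𝟙_ C)) =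
        (ρ_ X).inv ≫ (S.ξ X ⊗ₘ S.ξ (𝟙_ C)) := by ext <;> simp
    rw [← Category.assoc (ρ_ S.Ξ).inv, ← Category.assoc, e, Category.assoc, S.ξ_meet, S.ξ_mono,
      Category.comp_id]
  meet_assoc := S.tensor₃_hom_ext fun W X Y => by
    have e₁ : ((S.ξ W ⊗ₘ S.ξ X) ⊗ₘ S.ξ Y) ≫ (S.meet ▷ S.Ξ) = S.ξ (W ⊗ X) ⊗ₘ S.ξ Y := by
      rw [← S.ξ_meet W X]
      ext
      · simp only [Category.assoc, whiskerRight_fst, tensorHom_fst, tensorHom_fst_assoc]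
      · simp only [Category.assoc, whiskerRight_snd, tensorHom_snd]
    have e₂ : ((S.ξ W ⊗ₘ S.ξ X) ⊗ₘ S.ξ Y) ≫ (α_ S.Ξ S.Ξ S.Ξ).hom ≫ (S.Ξ ◁ S.meet) =
        (α_ W X Y).hom ≫ (S.ξ W ⊗ₘ S.ξ (X ⊗ Y)) := by
      rw [associator_naturality_assoc, ← S.ξ_meet X Y]
      congr 1
      ext <;> simp
    have h₁ := congrArg (· ≫ S.meet) e₁
    have h₂ := congrArg (· ≫ S.meet) e₂
    simp only [Category.assoc, S.ξ_meet, S.ξ_mono] at h₁ h₂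
    rw [h₁, h₂]
  meet_comm := S.tensor_hom_ext fun X Y => by
    have e : (S.ξ X ⊗ₘ S.ξ Y) ≫ swap S.Ξ S.Ξ = swap X Y ≫ (S.ξ Y ⊗ₘ S.ξ X) := by ext <;> simp
    have : Mono (swap X Y) := ⟨fun a b h => by
      have h1 := congrArg (· ≫ fst _ _) h
      have h2 := congrArg (· ≫ snd _ _) h
      simp only [Category.assoc, lift_fst, lift_snd] at h1 h2
      ext
      · exact h2
      · exact h1⟩
    rw [← Category.assoc, e, Category.assoc, S.ξ_meet, S.ξ_meet, S.ξ_mono]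
  meet_idem := S.ξ_hom_ext fun X => by
    have e : S.ξ X ≫ lift (𝟙 S.Ξ) (𝟙 S.Ξ) = lift (𝟙 X) (𝟙 X) ≫ (S.ξ X ⊗ₘ S.ξ X) := by
      ext <;> simp
    rw [← Category.assoc, e, Category.assoc, S.ξ_meet, S.ξ_mono, Category.comp_id]

end LocalStateClassifier

end LSC

namespace LSC

/-! ### Generalized elements of internal semilattices and filters -/

/-! Up to equivalence, a hyperconnected quotient is its essential image, a full subcategory `P` of
`E` closed under subobjects and finite products and coreflective with monic counits. Closure under
subobjects makes the counits `f^* f_* X ⟶ X` stable under pullback along monomorphisms, so their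
characteristic maps form a cocone on the monomorphisms of `E` and induce one map `Ξ ⟶ Ω`
(`exists_hom`). Closure under products makes this map preserve finite meets. Homomorphisms to `Ω`
are the same as filters (`filterEquivHom`), which is checked on generalized elements.

Conversely, a filter `F` gives the class of those `X` whose `ξ_X` factors through `F`. The key point
is `inf_ξ`: the graph of any `t : T ⟶ X` is monic, so `ξ_T ∧ (ξ_X ∘ t) = ξ_T`. Upward closure then
shows that maps out of objects of the class land in the pullback of `F` along `ξ_X`, which is
therefore the coreflection of `X`. Such a class is a topos (`elementaryTopos`): finite limits are
those of `E`, while exponentials and `Ω` are coreflected from `E`.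

For sheaves on a small site, a section over `c` is recorded only through its kernel pair on the
representable presheaf of `c`. Sections with equal kernel pairs generate isomorphic subpresheaves,
so a cocone on monomorphisms cannot separate them. There is only a set of kernel pairs for each `c`,
and `Ξ` is the sheafification of the presheaf they form. -/

theorem factors_iff_exists {C : Type u} [Category.{v} C] {X T : C} (P : Subobject X) (t : T ⟶ X) :
    P.Factors t ↔ ∃ s : T ⟶ (P : C), s ≫ P.arrow = t :=
  ⟨fun h => ⟨_, P.factorThru_arrow t h⟩, fun ⟨_, h⟩ => h ▸ P.factors_comp_arrow _⟩

section Elements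

variable {C : Type u} [Category.{v} C] [CartesianMonoidalCategory C]

namespace InternalSemilattice

variable (A : InternalSemilattice C) {T : C}

/-- The meet of two generalized elements. -/
def inf (a b : T ⟶ A.carrier) : T ⟶ A.carrier := lift a b ≫ A.meet

theorem comp_inf {T' : C} (t : T' ⟶ T) (a b : T ⟶ A.carrier) :
    t ≫ A.inf a b = A.inf (t ≫ a) (t ≫ b) := by
  rw [inf, inf, comp_lift_assoc]

theorem inf_comm (a b : T ⟶ A.carrier) : A.inf a b = A.inf b a := by
  have h := congrArg (lift b a ≫ ·) A.meet_comm
  simpa only [inf, comp_lift_assoc, lift_fst, lift_snd] using h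

theorem inf_self (a : T ⟶ A.carrier) : A.inf a a = a := by
  have h := congrArg (a ≫ ·) A.meet_idem
  simpa only [inf, comp_lift_assoc, Category.comp_id] using h

theorem inf_assoc (a b d : T ⟶ A.carrier) :
    A.inf (A.inf a b) d = A.inf a (A.inf b d) := by
  have h := congrArg (lift (lift a b) d ≫ ·) A.meet_assoc
  simpa only [inf, lift_whiskerRight_assoc, lift_lift_associator_hom_assoc,
    lift_whiskerLeft_assoc] using h

theorem inf_inf_left (a b : T ⟶ A.carrier) : A.inf (A.inf a b) a = A.inf a b := by
  rw [A.inf_comm, ← inf_assoc, inf_self]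

theorem inf_inf_right (a b : T ⟶ A.carrier) : A.inf (A.inf a b) b = A.inf a b := by
  rw [inf_assoc, inf_self]

end InternalSemilattice

namespace InternalFilter

variable [HasFiniteLimits C] {A : InternalSemilattice C}

theorem top_mem (F : InternalFilter A) : F.sub.Factors A.top := by
  obtain ⟨t, ht⟩ := F.top_closed
  exact (factors_iff_exists _ _).2 ⟨t, ht⟩

theorem inf_mem (F : InternalFilter A) {T : C} {a b : T ⟶ A.carrier}
    (ha : F.sub.Factors a) (hb : F.sub.Factors b) : F.sub.Factors (A.inf a b) := by
  obtain ⟨d, hd⟩ := F.meet_closed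
  have h := congrArg (lift (F.sub.factorThru a ha) (F.sub.factorThru b hb) ≫ ·) hd
  simp only [lift_map_assoc, Subobject.factorThru_arrow] at h
  exact (factors_iff_exists _ _).2 ⟨_, (Category.assoc _ _ _).trans h⟩

theorem mem_of_inf_eq (F : InternalFilter A) {T : C} {a x : T ⟶ A.carrier}
    (ha : F.sub.Factors a) (h : A.inf a x = a) : F.sub.Factors x := by
  obtain ⟨l, hl⟩ := F.upward_closed
  -- The pair `(a, x)` lies in the equalizer defining upward closure; the second component of its
  -- image under `l` is then a lift of `x` to `F`.
  have e : lift (F.sub.factorThru a ha) x ≫ (F.sub.arrow ▷ A.carrier) ≫ A.meet =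
      lift (F.sub.factorThru a ha) x ≫ fst (F.sub : C) A.carrier ≫ F.sub.arrow := by
    rw [lift_whiskerRight_assoc, lift_fst_assoc, Subobject.factorThru_arrow]
    exact h
  have h2 := congrArg (equalizer.lift _ e ≫ · ≫ snd _ _) hl
  simp only [Category.assoc, whiskerLeft_snd, equalizer.lift_ι_assoc, lift_snd] at h2
  exact (factors_iff_exists _ _).2
    ⟨equalizer.lift _ e ≫ l ≫ snd _ _, by simpa only [Category.assoc] using h2⟩

/-- An internal filter from its closure properties on generalized elements. -/
def ofMem (P : Subobject A.carrier) (top : P.Factors A.top)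
    (inf : ∀ {T : C} (a b : T ⟶ A.carrier), P.Factors a → P.Factors b → P.Factors (A.inf a b))
    (up : ∀ {T : C} (a x : T ⟶ A.carrier), P.Factors a → A.inf a x = a → P.Factors x) :
    InternalFilter A where
  sub := P
  top_closed := ⟨P.factorThru _ top, P.factorThru_arrow _ top⟩
  meet_closed := by
    -- The two projections are the generic pair of elements of `P`.
    have h := inf (fst (P : C) (P : C) ≫ P.arrow) (snd (P : C) (P : C) ≫ P.arrow)
      (P.factors_of_factors_right _ (P.factors_self))
      (P.factors_of_factors_right _ (P.factors_self))
    refine ⟨P.factorThru _ h, ?_⟩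
    rw [P.factorThru_arrow, InternalSemilattice.inf]
    congr 1
    ext <;> simp
  upward_closed := by
    -- The equalizer carries the generic pair `(a, x)` with `a` in `P` and `a ∧ x = a`.
    set i := equalizer.ι ((P.arrow ▷ A.carrier) ≫ A.meet) (fst (P : C) A.carrier ≫ P.arrow)
    have hi : i ≫ (P.arrow ▷ A.carrier) ≫ A.meet = i ≫ fst (P : C) A.carrier ≫ P.arrow :=
      equalizer.condition _ _
    have e : A.inf (i ≫ fst _ _ ≫ P.arrow) (i ≫ snd _ _) = i ≫ fst _ _ ≫ P.arrow := by
      rw [← A.comp_inf, ← hi, InternalSemilattice.inf]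
      congr 2
      ext <;> simp
    have h := up _ _ (P.factors_of_factors_right _ (P.factors_of_factors_right _ P.factors_self)) e
    refine ⟨lift (i ≫ fst _ _) (P.factorThru _ h), ?_⟩
    rw [lift_whiskerLeft, P.factorThru_arrow]
    ext <;> simp

end InternalFilter

end Elements

/-! ### Filters and homomorphisms to the subobject classifier -/

section Characteristic

variable {C : Type u} [Category.{v} C] [CartesianMonoidalCategory C]
  (c : Subobject.Classifier C)

theorem comp_χ_arrow_eq_true_iff {T X : C} (P : Subobject X) (t : T ⟶ X) :
    t ≫ c.χ P.arrow = toUnit T ≫ trueElt c ↔ P.Factors t := by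
  rw [comp_χ_eq_true_iff, factors_iff_exists]

theorem subobject_ext {X : C} {P Q : Subobject X} (h : c.χ P.arrow = c.χ Q.arrow) : P = Q := by
  apply le_antisymm
  · refine Subobject.le_of_comm (Q.factorThru P.arrow ?_) (Subobject.factorThru_arrow _ _ _)
    rw [← comp_χ_arrow_eq_true_iff c, ← h, comp_χ_arrow_eq_true_iff]
    exact P.factors_self
  · refine Subobject.le_of_comm (P.factorThru Q.arrow ?_) (Subobject.factorThru_arrow _ _ _)
    rw [← comp_χ_arrow_eq_true_iff c, h, comp_χ_arrow_eq_true_iff]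
    exact Q.factors_self

theorem exists_subobject_χ_arrow_eq [HasPullbacks C] {X : C} (f : X ⟶ c.Ω) :
    ∃ P : Subobject X, c.χ P.arrow = f := by
  obtain ⟨Z, i, _, rfl⟩ := c.surjective_χ f
  refine ⟨Subobject.mk i, omega_ext c fun T t => ?_⟩
  rw [comp_χ_arrow_eq_true_iff, comp_χ_eq_true_iff]
  exact Subobject.mk_factors_iff i t

variable [HasFiniteLimits C] {A : InternalSemilattice C}

/-- The characteristic map of an internal filter is a homomorphism of semilattices. -/
noncomputable def InternalFilter.toHom (F : InternalFilter A) : SemilatticeHom A (omegaSemilattice c) where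
  hom := c.χ F.sub.arrow
  map_top := by
    have h := (comp_χ_arrow_eq_true_iff c F.sub A.top).2 F.top_mem
    rwa [toUnit_unique (toUnit (𝟙_ C)) (𝟙 _), Category.id_comp] at h
  map_meet := omega_ext c fun T t => by
    obtain ⟨a, b, rfl⟩ : ∃ a b, t = lift a b := ⟨t ≫ fst _ _, t ≫ snd _ _, by simp⟩
    rw [lift_map_assoc]
    refine Iff.trans ?_ (lift_meet_eq_true_iff c _ _).symm
    rw [← Category.assoc, comp_χ_arrow_eq_true_iff, comp_χ_arrow_eq_true_iff,
      comp_χ_arrow_eq_true_iff]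
    exact ⟨fun h => ⟨F.mem_of_inf_eq h (A.inf_inf_left a b),
      F.mem_of_inf_eq h (A.inf_inf_right a b)⟩, fun h => F.inf_mem h.1 h.2⟩

/-- Preservation of `∧` means that `a ∧ b` lies in the classified subobject exactly when both `a`
and `b` do. One direction is closure under meets; the other, applied to `a ∧ x = a`, is upward
closure. -/
theorem InternalFilter.exists_toHom_eq (h : SemilatticeHom A (omegaSemilattice c)) :
    ∃ F : InternalFilter A, F.toHom c = h := by
  obtain ⟨P, hP⟩ := exists_subobject_χ_arrow_eq c h.hom
  have mem {T : C} (t : T ⟶ A.carrier) :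
      P.Factors t ↔ t ≫ h.hom = toUnit T ≫ trueElt c := by
    rw [← hP, comp_χ_arrow_eq_true_iff]
  have mem_inf {T : C} (a b : T ⟶ A.carrier) :
      P.Factors (A.inf a b) ↔ P.Factors a ∧ P.Factors b := by
    rw [mem, mem, mem, ← lift_meet_eq_true_iff, InternalSemilattice.inf, Category.assoc,
      h.map_meet, lift_map_assoc]
  refine ⟨ofMem P ?_ (fun a b ha hb => (mem_inf a b).2 ⟨ha, hb⟩) (fun a x ha hx => ?_),
    SemilatticeHom.ext hP⟩
  · rw [mem, h.map_top, toUnit_unique (toUnit (𝟙_ C)) (𝟙 _), Category.id_comp]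
  · exact ((mem_inf a x).1 (hx.symm ▸ ha)).2

/-- Internal filters correspond to homomorphisms to the subobject classifier. -/
noncomputable def filterEquivHom :
    InternalFilter A ≃ SemilatticeHom A (omegaSemilattice c) :=
  Equiv.ofBijective (InternalFilter.toHom c)
    ⟨fun _ _ h => InternalFilter.ext (subobject_ext c (congrArg SemilatticeHom.hom h)),
      InternalFilter.exists_toHom_eq c⟩

end Characteristic

theorem LocalStateClassifier.exists_desc {C : Type u} [Category.{v} C]
    (S : LocalStateClassifier C) {Z : C} (ψ : ∀ X, X ⟶ Z)
    (hψ : ∀ {X Y : C} (m : X ⟶ Y) [Mono m], m ≫ ψ Y = ψ X) :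
    ∃ d : S.Ξ ⟶ Z, ∀ X, S.ξ X ≫ d = ψ X := by
  let t : Cocone (monoInclusion C) :=
    { pt := Z
      ι := { app := fun j => ψ j.obj
             naturality := fun j k m => by
               have : Mono m.hom := m.property
               exact (hψ m.hom).trans (Category.comp_id _).symm } }
  exact ⟨S.isColimit.desc t, fun X => S.isColimit.fac t ⟨X⟩⟩

/-! ### The filter of a hyperconnected geometric morphism -/

namespace HyperconnectedFrom

section Equivalence

variable {E : Type u} [Category.{v} E] (Q Q' : HyperconnectedFrom E)

instance : Q.morphism.inverseImage.Full := Q.hyperconnected.full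

instance : Q.morphism.inverseImage.Faithful := Q.hyperconnected.faithful

instance : PreservesFiniteLimits Q.morphism.inverseImage := Q.morphism.leftExact

/-- Precomposing with an equivalence leaves the essential image unchanged. Conversely, each fully
faithful `f^*` is an equivalence onto its essential image, so a common image can be used to compare
the two targets. -/
theorem equivalent_iff : Q.Equivalent Q' ↔ Q.inverseImage.essImage = Q'.inverseImage.essImage := by
  constructor
  · rintro ⟨e, ⟨i⟩⟩
    rw [← Functor.essImage_eq_of_natIso i, Functor.essImage_comp_of_essSurj]
  · intro h
    let I := ObjectProperty.ιOfLE h.ge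
    have : I.EssSurj := ⟨fun X => ⟨⟨X.obj, h ▸ X.property⟩, ⟨Iso.refl _⟩⟩⟩
    have : I.Full := ObjectProperty.full_ιOfLE h.ge
    have : I.Faithful := ObjectProperty.faithful_ιOfLE h.ge
    have : I.IsEquivalence := { }
    have : Q.inverseImage.toEssImage.IsEquivalence := { }
    have : Q'.inverseImage.toEssImage.IsEquivalence := { }
    let G := Q'.inverseImage.toEssImage ⋙ I ⋙ Q.inverseImage.toEssImage.inv
    refine ⟨G.asEquivalence.symm, ⟨?_⟩⟩
    exact Functor.associator _ _ _ ≪≫ Functor.isoWhiskerLeft _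
      (Functor.associator _ _ _ ≪≫ Functor.isoWhiskerLeft I
        (Functor.isoWhiskerRight Q.inverseImage.toEssImage.asEquivalence.counitIso
          Q.inverseImage.essImage.ι))

theorem exists_comp_counit_eq {T X : E} (hT : Q.inverseImage.essImage T) (t : T ⟶ X) :
    ∃ s, s ≫ Q.counit X = t := by
  obtain ⟨D, ⟨i⟩⟩ := hT
  refine ⟨i.inv ≫ Q.inverseImage.map (Q.morphism.adj.homEquiv _ _ (i.hom ≫ t)), ?_⟩
  rw [Category.assoc, ← Q.morphism.adj.homEquiv_counit, Equiv.symm_apply_apply,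
    Iso.inv_hom_id_assoc]

/-- The right-hand side mentions only the essential image, so closure properties of the image
translate into statements about the counits. -/
theorem exists_comp_counit_eq_iff {T X : E} (t : T ⟶ X) :
    (∃ s, s ≫ Q.counit X = t) ↔
      ∃ W, Q.inverseImage.essImage W ∧ ∃ (a : T ⟶ W) (b : W ⟶ X), a ≫ b = t := by
  constructor
  · rintro ⟨s, hs⟩
    exact ⟨_, Q.inverseImage.obj_mem_essImage _, s, _, hs⟩
  · rintro ⟨W, hW, a, b, rfl⟩
    obtain ⟨s, rfl⟩ := Q.exists_comp_counit_eq hW b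
    exact ⟨a ≫ s, Category.assoc _ _ _⟩

theorem essImage_of_mono {X Y : E} (m : X ⟶ Y) [Mono m] (hY : Q.inverseImage.essImage Y) :
    Q.inverseImage.essImage X :=
  Q.hyperconnected.closed_subobjects m hY

/-- A section of the counit exhibits `X` as a subobject of `f^* f_* X`. -/
theorem essImage_iff (X : E) :
    Q.inverseImage.essImage X ↔ ∃ s, s ≫ Q.counit X = 𝟙 X := by
  refine ⟨fun h => Q.exists_comp_counit_eq h _, fun ⟨s, hs⟩ => ?_⟩
  have : Mono s := ⟨fun a b h => by
    simpa only [Category.assoc, hs, Category.comp_id] using congrArg (· ≫ Q.counit X) h⟩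
  exact Q.essImage_of_mono s (Q.inverseImage.obj_mem_essImage _)

/-- The coreflections of `E` onto the essential image of `f^*` are stable under pullback along
monomorphisms. -/
theorem exists_comp_counit_mono_iff [HasPullbacks E] {T X Y : E} (m : X ⟶ Y) [Mono m]
    (t : T ⟶ X) : (∃ s, s ≫ Q.counit Y = t ≫ m) ↔ ∃ s, s ≫ Q.counit X = t := by
  constructor
  · rintro ⟨s, hs⟩
    rw [exists_comp_counit_eq_iff]
    -- This pullback is a subobject of `f^* f_* Y`, since `m` is monic, hence lies in the essential
    -- image.
    exact ⟨pullback (Q.counit Y) m,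
      Q.essImage_of_mono (pullback.fst _ _) (Q.inverseImage.obj_mem_essImage _),
      pullback.lift s t hs, pullback.snd _ _, pullback.lift_snd _ _ _⟩
  · rintro ⟨s, rfl⟩
    rw [exists_comp_counit_eq_iff]
    exact ⟨_, Q.inverseImage.obj_mem_essImage _, s, Q.counit X ≫ m, by rw [Category.assoc]⟩

end Equivalence

variable {E : Type u} [Category.{v} E] [CartesianMonoidalCategory E]

section

variable (Q : HyperconnectedFrom E)

theorem essImage_unit : Q.inverseImage.essImage (𝟙_ E) :=
  ObjectProperty.prop_of_isLimit _ isTerminalTensorUnit (by simp)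

theorem essImage_tensor {X Y : E} (hX : Q.inverseImage.essImage X)
    (hY : Q.inverseImage.essImage Y) : Q.inverseImage.essImage (X ⊗ Y) :=
  ObjectProperty.prop_of_isLimit _ (tensorProductIsBinaryProduct X Y)
    (by rintro ⟨_ | _⟩ <;> assumption)

/-- The kernel pair of the counit is a subobject of a product of objects in the image, so it lies in
the image too. By fullness its two projections come from maps into `f_* X`; these have the same
transpose, hence are equal. -/
instance mono_counit [HasPullbacks E] (X : E) : Mono (Q.counit X) := by
  let A := Q.inverseImage.obj (Q.morphism.directImage.obj X)
  let p : pullback (Q.counit X) (Q.counit X) ⟶ A := pullback.fst _ _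
  let q : pullback (Q.counit X) (Q.counit X) ⟶ A := pullback.snd _ _
  have hA : Q.inverseImage.essImage A := Q.inverseImage.obj_mem_essImage _
  have : Mono (lift p q) := ⟨fun a b h => by
    have h1 := congrArg (· ≫ fst _ _) h
    have h2 := congrArg (· ≫ snd _ _) h
    simp only [Category.assoc, lift_fst, lift_snd] at h1 h2
    exact pullback.hom_ext h1 h2⟩
  obtain ⟨D, ⟨i⟩⟩ := Q.essImage_of_mono (lift p q) (Q.essImage_tensor hA hA)
  have hpq : p = q := by
    obtain ⟨p', hp⟩ := Q.inverseImage.map_surjective (i.hom ≫ p)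
    obtain ⟨q', hq⟩ := Q.inverseImage.map_surjective (i.hom ≫ q)
    have h : p' = q' := by
      apply (Q.morphism.adj.homEquiv _ _).symm.injective
      rw [Adjunction.homEquiv_counit, Adjunction.homEquiv_counit, hp, hq, Category.assoc,
        Category.assoc]
      exact congrArg (i.hom ≫ ·) pullback.condition
    rw [← cancel_epi i.hom, ← hp, ← hq, h]
  refine ⟨fun a b h => ?_⟩
  exact (pullback.lift_fst a b h).symm.trans
    ((congrArg (pullback.lift a b h ≫ ·) hpq).trans (pullback.lift_snd a b h))

theorem exists_comp_counit_tensor_iff {T X Y : E} (t : T ⟶ X ⊗ Y) :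
    (∃ s, s ≫ Q.counit (X ⊗ Y) = t) ↔
      (∃ s, s ≫ Q.counit X = t ≫ fst X Y) ∧ ∃ s, s ≫ Q.counit Y = t ≫ snd X Y := by
  simp only [exists_comp_counit_eq_iff]
  constructor
  · rintro ⟨W, hW, a, b, rfl⟩
    exact ⟨⟨W, hW, a, b ≫ fst _ _, by simp⟩, ⟨W, hW, a, b ≫ snd _ _, by simp⟩⟩
  · rintro ⟨⟨W, hW, a, b, h⟩, ⟨W', hW', a', b', h'⟩⟩
    refine ⟨W ⊗ W', Q.essImage_tensor hW hW', lift a a', b ⊗ₘ b', ?_⟩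
    rw [lift_map, h, h']
    ext <;> simp

end

/-! ### From counits to a homomorphism and a filter -/

variable [ElementaryTopos E] (S : LocalStateClassifier E) (c : Subobject.Classifier E)

theorem exists_hom (Q : HyperconnectedFrom E) :
    ∃ h : S.Ξ ⟶ c.Ω, ∀ X, S.ξ X ≫ h = c.χ (Q.counit X) := by
  refine S.exists_desc (fun X => c.χ (Q.counit X)) fun m _ => omega_ext c fun T t => ?_
  rw [← Category.assoc, comp_χ_eq_true_iff, comp_χ_eq_true_iff]
  exact Q.exists_comp_counit_mono_iff m t

/-- The homomorphism `Ξ ⟶ Ω` whose composition with `ξ_X` classifies the counit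
`f^* f_* X ⟶ X`. -/
noncomputable def toHom (Q : HyperconnectedFrom E) :
    SemilatticeHom S.semilattice (omegaSemilattice c) where
  hom := (Q.exists_hom S c).choose
  map_top := by
    refine ((Q.exists_hom S c).choose_spec (𝟙_ E)).trans ?_
    have h := (comp_χ_eq_true_iff c (Q.counit (𝟙_ E)) (𝟙 _)).2
      ((Q.essImage_iff _).1 Q.essImage_unit)
    rwa [Category.id_comp, toUnit_unique (toUnit (𝟙_ E)) (𝟙 _), Category.id_comp] at h
  map_meet := S.tensor_hom_ext fun X Y => by
    have h := (Q.exists_hom S c).choose_spec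
    generalize (Q.exists_hom S c).choose = k at h
    rw [← Category.assoc, S.ξ_meet, h, ← Category.assoc]
    refine omega_ext c fun T t => ?_
    have e : t ≫ (((S.ξ X ⊗ₘ S.ξ Y) ≫ (k ⊗ₘ k)) ≫ omegaMeet c) =
        lift ((t ≫ fst X Y) ≫ c.χ (Q.counit X)) ((t ≫ snd X Y) ≫ c.χ (Q.counit Y)) ≫
          omegaMeet c := by
      rw [← h X, ← h Y, ← Category.assoc]
      congr 1
      ext <;> simp
    refine Iff.trans ?_ (Eq.congr_left e).symm
    rw [lift_meet_eq_true_iff, comp_χ_eq_true_iff, comp_χ_eq_true_iff, comp_χ_eq_true_iff]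
    exact Q.exists_comp_counit_tensor_iff t

theorem ξ_toHom (Q : HyperconnectedFrom E) (X : E) :
    S.ξ X ≫ (Q.toHom S c).hom = c.χ (Q.counit X) :=
  (Q.exists_hom S c).choose_spec X

/-- The filter of `Ξ` whose pullback along `ξ_X` is the counit `f^* f_* X ⟶ X`. -/
noncomputable def toFilter (Q : HyperconnectedFrom E) : InternalFilter S.semilattice :=
  (filterEquivHom c).symm (Q.toHom S c)

theorem χ_toFilter (Q : HyperconnectedFrom E) :
    c.χ (Q.toFilter S c).sub.arrow = (Q.toHom S c).hom :=
  congrArg SemilatticeHom.hom ((filterEquivHom c).apply_symm_apply (Q.toHom S c))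

theorem factors_toFilter_iff (Q : HyperconnectedFrom E) {T X : E} (t : T ⟶ X) :
    (Q.toFilter S c).sub.Factors (t ≫ S.ξ X) ↔ ∃ s, s ≫ Q.counit X = t := by
  rw [← comp_χ_arrow_eq_true_iff c, χ_toFilter, Category.assoc, ξ_toHom, comp_χ_eq_true_iff]

theorem essImage_iff_factors_toFilter (Q : HyperconnectedFrom E) (X : E) :
    Q.inverseImage.essImage X ↔ (Q.toFilter S c).sub.Factors (S.ξ X) := by
  rw [essImage_iff, ← Q.factors_toFilter_iff S c, Category.id_comp]

theorem exists_isPullback_counit (Q : HyperconnectedFrom E) (X : E) :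
    ∃ p, IsPullback (Q.counit X) p (S.ξ X) (Q.toFilter S c).sub.arrow := by
  have h := (Q.factors_toFilter_iff S c (Q.counit X)).2 ⟨𝟙 _, Category.id_comp _⟩
  have k (s : PullbackCone (S.ξ X) (Q.toFilter S c).sub.arrow) :
      ∃ l, l ≫ Q.counit X = s.fst :=
    (Q.factors_toFilter_iff S c s.fst).1 (s.condition ▸ Subobject.factors_comp_arrow _)
  choose l hl using k
  have w := (Subobject.factorThru_arrow (Q.toFilter S c).sub _ h).symm
  refine ⟨_, ⟨w⟩, ⟨PullbackCone.IsLimit.mk _ l hl (fun s => ?_) (fun s m hm _ => ?_)⟩⟩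
  · rw [← cancel_mono (Q.toFilter S c).sub.arrow, ← s.condition, Category.assoc, ← w,
      ← Category.assoc, hl]
  · rw [← cancel_mono (Q.counit X), hm, hl]

/-- A filter determines the image through membership of `ξ_X`. Conversely, the image determines
which maps factor through each counit, hence the pullbacks of the filter along all `ξ_X`, and the
`ξ_X` are jointly epic. -/
theorem toFilter_eq_iff (Q Q' : HyperconnectedFrom E) :
    Q.toFilter S c = Q'.toFilter S c ↔ Q.Equivalent Q' := by
  rw [equivalent_iff]
  constructor
  · intro h
    ext X
    rw [Q.essImage_iff_factors_toFilter S c, Q'.essImage_iff_factors_toFilter S c, h]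
  · intro h
    refine InternalFilter.ext (subobject_ext c (S.ξ_hom_ext fun X => omega_ext c fun T t => ?_))
    rw [← Category.assoc, ← Category.assoc, comp_χ_arrow_eq_true_iff, comp_χ_arrow_eq_true_iff,
      factors_toFilter_iff, factors_toFilter_iff, exists_comp_counit_eq_iff,
      exists_comp_counit_eq_iff, h]

end HyperconnectedFrom

/-! ### Coreflective full subcategories closed under subobjects and finite products -/

/-- A property of objects that is closed under subobjects and finite products, and such that
every object has a largest subobject with the property, through which every morphism from an
object with the property factors. -/
structure IsHyperconnectedProperty {E : Type u} [Category.{v} E] [CartesianMonoidalCategory E]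
    (P : ObjectProperty E) : Prop where
  of_mono : ∀ {X Y : E} (m : X ⟶ Y) [Mono m], P Y → P X
  unit : P (𝟙_ E)
  tensor : ∀ {X Y : E}, P X → P Y → P (X ⊗ Y)
  exists_coreflection : ∀ X : E, ∃ (W : E) (_ : P W) (ε : W ⟶ X) (_ : Mono ε),
    ∀ {T : E} (_ : P T) (t : T ⟶ X), ∃ s, s ≫ ε = t

theorem isPullback_toUnit_iff {E : Type u} [Category.{v} E] [CartesianMonoidalCategory E]
    {U X Y : E} (m : U ⟶ X) [Mono m] (f : X ⟶ Y) (p : U ⟶ 𝟙_ E) (y : 𝟙_ E ⟶ Y) :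
    IsPullback m p f y ↔
      ∀ (T : E) (t : T ⟶ X), t ≫ f = toUnit T ≫ y ↔ ∃ s, s ≫ m = t := by
  obtain rfl := toUnit_unique p (toUnit U)
  constructor
  · intro h T t
    constructor
    · intro ht
      exact ⟨h.lift t (toUnit T) ht, h.lift_fst _ _ _⟩
    · rintro ⟨s, rfl⟩
      rw [Category.assoc, h.w, ← Category.assoc, comp_toUnit]
  · intro h
    have k (s : PullbackCone f y) : ∃ l, l ≫ m = s.fst :=
      (h _ s.fst).1 (by rw [s.condition, toUnit_unique s.snd (toUnit _)])
    choose l hl using k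
    exact ⟨⟨(h U m).2 ⟨𝟙 _, Category.id_comp _⟩⟩,
      ⟨PullbackCone.IsLimit.mk _ l hl (fun s => toUnit_unique _ _)
        (fun s n hn _ => by rw [← cancel_mono m, hn, hl])⟩⟩

namespace IsHyperconnectedProperty

variable {E : Type u} [Category.{v} E] [CartesianMonoidalCategory E] {P : ObjectProperty E}

/-- The largest subobjects form the right adjoint; uniqueness of lifts and naturality follow by
cancelling the monic `ε`. -/
theorem isLeftAdjoint_ι (hP : IsHyperconnectedProperty P) : P.ι.IsLeftAdjoint := by
  choose W hW ε hε l hl using hP.exists_coreflection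
  refine ⟨_, ⟨Adjunction.adjunctionOfEquivRight (F := P.ι) (G_obj := fun X => ⟨W X, hW X⟩)
    (fun T X => ⟨fun t => ObjectProperty.homMk (l X T.property t), fun s => s.hom ≫ ε X,
      fun t => hl _ _ _, fun s => ?_⟩) (fun T' T X f g => ?_)⟩⟩
  · ext
    rw [← cancel_mono (ε X)]
    exact hl _ _ _
  · ext
    rw [← cancel_mono (ε X)]
    refine (hl _ _ _).trans ?_
    have h := hl X T.property g
    simp [h]

theorem isClosedUnderLimitsOfShape_pempty (hP : IsHyperconnectedProperty P) :
    P.IsClosedUnderLimitsOfShape (Discrete PEmpty.{1}) := by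
  refine ⟨fun X ⟨h⟩ => ?_⟩
  have hX : IsTerminal X := IsTerminal.ofUniqueHom
    (fun Y => h.isLimit.lift ⟨Y, { app := fun j => j.as.elim }⟩)
    (fun Y m => h.isLimit.hom_ext fun j => j.as.elim)
  have := hX.mono_from (toUnit X)
  exact hP.of_mono (hX.uniqueUpToIso isTerminalTensorUnit).hom hP.unit

theorem isClosedUnderLimitsOfShape_walkingCospan (hP : IsHyperconnectedProperty P) :
    P.IsClosedUnderLimitsOfShape WalkingCospan := by
  refine ⟨fun X ⟨h⟩ => ?_⟩
  let p := h.π.app WalkingCospan.left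
  let q := h.π.app WalkingCospan.right
  -- A pullback embeds in the product of the two outer objects.
  have : Mono (CartesianMonoidalCategory.lift p q) := ⟨fun a b e => by
    have h1 : a ≫ p = b ≫ p := by simpa using congrArg (· ≫ fst _ _) e
    have h2 : a ≫ q = b ≫ q := by simpa using congrArg (· ≫ snd _ _) e
    refine h.isLimit.hom_ext fun j => ?_
    rcases j with _ | _ | _
    · have hw := h.π.naturality WalkingCospan.Hom.inl
      simp only [Functor.const_obj_obj, Functor.const_obj_map, Category.id_comp] at hw
      change a ≫ h.π.app WalkingCospan.one = b ≫ h.π.app WalkingCospan.one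
      rw [hw, ← Category.assoc, ← Category.assoc]
      exact congrArg (· ≫ _) h1
    · exact h1
    · exact h2⟩
  exact hP.of_mono (CartesianMonoidalCategory.lift p q)
    (hP.tensor (h.prop_diag_obj _) (h.prop_diag_obj _))

theorem hasFiniteLimits [HasFiniteLimits E] (hP : IsHyperconnectedProperty P) :
    HasFiniteLimits P.FullSubcategory :=
  have := hP.isClosedUnderLimitsOfShape_pempty
  have := hP.isClosedUnderLimitsOfShape_walkingCospan
  hasFiniteLimits_of_hasTerminal_and_pullbacks

theorem preservesFiniteLimits_ι [HasFiniteLimits E] (hP : IsHyperconnectedProperty P) :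
    PreservesFiniteLimits P.ι :=
  have := hP.isClosedUnderLimitsOfShape_pempty
  have := hP.isClosedUnderLimitsOfShape_walkingCospan
  preservesFiniteLimits_of_preservesTerminal_and_pullbacks _

/-- The classifier is the coreflection `W` of `Ω`. Both `true` and the characteristic maps of
monomorphisms in the subcategory have domain in `P`, so they factor through `ε : W ⟶ Ω`; as `ε` is
monic, the pullback conditions for `W` and for `Ω` agree. -/
theorem hasSubobjectClassifier [HasFiniteLimits E] (c : Subobject.Classifier E)
    (hP : IsHyperconnectedProperty P) : HasSubobjectClassifier P.FullSubcategory := by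
  obtain ⟨W, hW, ε, _, hε⟩ := hP.exists_coreflection c.Ω
  obtain ⟨y, hy⟩ := hε hP.unit (trueElt c)
  have := hP.hasFiniteLimits
  have := hP.preservesFiniteLimits_ι
  have k {U X : P.FullSubcategory} (m : U ⟶ X) [Mono m] : ∃ χ : X.obj ⟶ W,
      χ ≫ ε = c.χ (P.ι.map m) := hε X.property _
  choose χ hχ using @k
  let I : P.FullSubcategory := ⟨𝟙_ E, hP.unit⟩
  let hI : IsTerminal I := IsTerminal.ofUniqueHom (fun X => ObjectProperty.homMk (toUnit X.obj))
    (fun X m => by ext)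
  refine ⟨⟨Subobject.Classifier.mkOfTerminalΩ₀ I hI ⟨W, hW⟩ (ObjectProperty.homMk y)
    (fun m _ => ObjectProperty.homMk (χ m)) (fun {U X} m _ => ?_) (fun {U X} m _ f hf => ?_)⟩⟩
  · have h : IsPullback (P.ι.map m) (toUnit U.obj) (χ m) y :=
      (isPullback_toUnit_iff _ _ _ _).2 fun T t => by
        rw [← comp_χ_eq_true_iff c, ← hχ, ← hy, ← Category.assoc, ← Category.assoc, cancel_mono]
    exact IsPullback.of_map P.ι (P.ι.map_injective h.w) h
  · ext
    rw [← cancel_mono ε]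
    refine Eq.trans (omega_ext c fun T t => ?_) (hχ m).symm
    have h := (isPullback_toUnit_iff (P.ι.map m) f.hom _ y).1 (hf.map P.ι) T t
    rw [comp_χ_eq_true_iff, ← h, ← hy, ← Category.assoc, ← Category.assoc, cancel_mono]

/-- The inclusion preserves products, so the exponential in the subcategory is the coreflection of
the one in `E`. -/
theorem isLeftAdjoint_prod [HasFiniteLimits E] [HasFiniteLimits P.FullSubcategory]
    [PreservesFiniteLimits P.ι] (hP : IsHyperconnectedProperty P) (X : P.FullSubcategory)
    (h : (prod.functor.obj X.obj).IsLeftAdjoint) : (prod.functor.obj X).IsLeftAdjoint := by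
  have := hP.isLeftAdjoint_ι
  let adj := (Adjunction.ofIsLeftAdjoint P.ι).comp
    (Adjunction.ofIsLeftAdjoint (prod.functor.obj X.obj))
  exact ⟨_, ⟨adj.restrictFullyFaithful (Functor.FullyFaithful.id _) P.fullyFaithfulι
    (Functor.leftUnitor _ ≪≫ (prodComparisonNatIso P.ι X).symm) (Functor.rightUnitor _).symm⟩⟩

theorem elementaryTopos [ElementaryTopos E] (hP : IsHyperconnectedProperty P) :
    ElementaryTopos P.FullSubcategory :=
  have := hP.hasFiniteLimits
  have := hP.preservesFiniteLimits_ι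
  have := hP.hasSubobjectClassifier HasSubobjectClassifier.exists_classifier.some
  { exponentiable := fun X =>
      hP.isLeftAdjoint_prod X (ElementaryTopos.exponentiable X.obj) }

theorem exists_essImage_eq [ElementaryTopos E] (hP : IsHyperconnectedProperty P) :
    ∃ Q : HyperconnectedFrom E, Q.inverseImage.essImage = P := by
  have := hP.elementaryTopos
  have := hP.isLeftAdjoint_ι
  have h : P.ι.essImage = P := by
    ext X
    exact ⟨fun ⟨Y, ⟨i⟩⟩ => hP.of_mono i.inv Y.property, fun h => ⟨⟨X, h⟩, ⟨Iso.refl _⟩⟩⟩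
  exact ⟨⟨P.FullSubcategory, ⟨_, P.ι, Adjunction.ofIsLeftAdjoint P.ι, hP.preservesFiniteLimits_ι⟩,
    ⟨inferInstance, inferInstance, by rw [h]; exact hP.of_mono⟩⟩, h⟩

end IsHyperconnectedProperty

/-! ### The hyperconnected quotient of a filter -/

section Filter

variable {E : Type u} [Category.{v} E] [CartesianMonoidalCategory E] [ElementaryTopos E]
  (S : LocalStateClassifier E)

/-- The graph `T ⟶ T ⊗ X` of `t` is monic, so `ξ_T` is the restriction of `ξ_{T ⊗ X}`, which is a
meet. -/
theorem LocalStateClassifier.inf_ξ {T X : E} (t : T ⟶ X) :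
    S.semilattice.inf (S.ξ T) (t ≫ S.ξ X) = S.ξ T := by
  have : Mono (lift (𝟙 T) t) := ⟨fun a b h => by simpa using congrArg (· ≫ fst _ _) h⟩
  refine Eq.trans ?_ (S.ξ_mono (lift (𝟙 T) t))
  rw [← S.ξ_meet T X, lift_map_assoc, Category.id_comp]
  rfl

theorem InternalFilter.factors_comp_ξ {S : LocalStateClassifier E}
    (F : InternalFilter S.semilattice) {T X : E} (t : T ⟶ X) (h : F.sub.Factors (S.ξ T)) :
    F.sub.Factors (t ≫ S.ξ X) :=
  F.mem_of_inf_eq h (S.inf_ξ t)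

variable {S}

theorem InternalFilter.exists_coreflection (F : InternalFilter S.semilattice) (X : E) :
    ∃ (W : E) (_ : F.sub.Factors (S.ξ W)) (ε : W ⟶ X) (_ : Mono ε),
      ∀ {T : E} (t : T ⟶ X), F.sub.Factors (t ≫ S.ξ X) → ∃ s, s ≫ ε = t := by
  refine ⟨pullback (S.ξ X) F.sub.arrow, ?_, pullback.fst _ _, inferInstance, fun t h =>
    ⟨pullback.lift t _ (Subobject.factorThru_arrow _ _ h).symm, pullback.lift_fst _ _ _⟩⟩
  -- The projection to `X` is monic, so `ξ_W` is its composite with `ξ_X`, and this factors through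
  -- `F` by construction.
  rw [← S.ξ_mono (pullback.fst (S.ξ X) F.sub.arrow), pullback.condition]
  exact Subobject.factors_comp_arrow _

theorem InternalFilter.isHyperconnectedProperty (F : InternalFilter S.semilattice) :
    IsHyperconnectedProperty (fun X : E => F.sub.Factors (S.ξ X)) where
  of_mono m _ h := S.ξ_mono m ▸ Subobject.factors_of_factors_right _ h
  unit := F.top_mem
  tensor {X Y} hX hY := by
    have h := F.inf_mem (Subobject.factors_of_factors_right (fst X Y) hX)
      (Subobject.factors_of_factors_right (snd X Y) hY)
    have e : lift (fst X Y ≫ S.ξ X) (snd X Y ≫ S.ξ Y) = S.ξ X ⊗ₘ S.ξ Y := by ext <;> simp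
    rw [InternalSemilattice.inf, e] at h
    exact S.ξ_meet X Y ▸ h
  exists_coreflection X := by
    obtain ⟨W, hW, ε, hε, h⟩ := F.exists_coreflection X
    exact ⟨W, hW, ε, hε, fun hT t => h t (F.factors_comp_ξ t hT)⟩

theorem InternalFilter.exists_toFilter_eq (c : Subobject.Classifier E)
    (F : InternalFilter S.semilattice) : ∃ Q : HyperconnectedFrom E, Q.toFilter S c = F := by
  obtain ⟨Q, hQ⟩ := F.isHyperconnectedProperty.exists_essImage_eq
  refine ⟨Q, InternalFilter.ext (subobject_ext c (S.ξ_hom_ext fun X => omega_ext c fun T t => ?_))⟩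
  rw [← Category.assoc, ← Category.assoc, comp_χ_arrow_eq_true_iff, comp_χ_arrow_eq_true_iff,
    Q.factors_toFilter_iff, Q.exists_comp_counit_eq_iff, hQ]
  constructor
  · rintro ⟨W, hW, a, b, rfl⟩
    rw [Category.assoc]
    exact Subobject.factors_of_factors_right _ (F.factors_comp_ξ b hW)
  · intro h
    obtain ⟨W, hW, ε, hε, hl⟩ := F.exists_coreflection X
    obtain ⟨s, hs⟩ := hl t h
    exact ⟨W, hW, s, ε, hs⟩

/-- Hyperconnected quotients correspond to internal filters of the local state classifier. -/
noncomputable def quotientEquivFilter (S : LocalStateClassifier E) (c : Subobject.Classifier E) :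
    HyperconnectedQuotient E ≃ InternalFilter S.semilattice :=
  Equiv.ofBijective
    (Quotient.lift (fun Q => Q.toFilter S c) fun Q Q' h => (Q.toFilter_eq_iff S c Q').2 h)
    ⟨fun q q' => Quotient.inductionOn₂ q q' fun Q Q' h =>
        Quotient.sound ((Q.toFilter_eq_iff S c Q').1 h),
      fun F => (F.exists_toFilter_eq c).imp' HyperconnectedFrom.toQuotient fun _ h => h⟩

end Filter

/-! ### Existence of local state classifiers in Grothendieck toposes -/

namespace LocalStateClassifier

theorem nonempty_of_universal {C : Type u} [Category.{v} C] (L : C) (ξ : ∀ X : C, X ⟶ L)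
    (hξ : ∀ {X Y : C} (m : X ⟶ Y) [Mono m], m ≫ ξ Y = ξ X)
    (desc : ∀ {Z : C} (ψ : ∀ X, X ⟶ Z),
      (∀ {X Y : C} (m : X ⟶ Y) [Mono m], m ≫ ψ Y = ψ X) → ∃ d : L ⟶ Z, ∀ X, ξ X ≫ d = ψ X)
    (ext : ∀ {Z : C} {f g : L ⟶ Z}, (∀ X, ξ X ≫ f = ξ X ≫ g) → f = g) :
    Nonempty (LocalStateClassifier C) := by
  have key (s : Cocone (monoInclusion C)) : ∃ d : L ⟶ s.pt, ∀ X, ξ X ≫ d = s.ι.app ⟨X⟩ :=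
    desc (fun X => s.ι.app ⟨X⟩) fun {X Y} m _ =>
      let X' : WideSubcategory (MorphismProperty.monomorphisms C) := ⟨X⟩
      let Y' : WideSubcategory (MorphismProperty.monomorphisms C) := ⟨Y⟩
      let m' : X' ⟶ Y' := ⟨m, MorphismProperty.monomorphisms.infer_property m⟩
      s.w m'
  choose d hd using key
  let t : Cocone (monoInclusion C) :=
    { pt := L
      ι := { app := fun j => ξ j.obj
             naturality := fun j k m => by
               have : Mono m.hom := m.property
               exact (hξ m.hom).trans (Category.comp_id _).symm } }
  exact ⟨⟨t, { desc := d
               fac := fun s j => hd s j.obj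
               uniq := fun s m hm => ext fun X => (hm ⟨X⟩).trans (hd s X).symm }⟩⟩

theorem nonempty_of_equivalence {C : Type u₁} [Category.{v₁} C] {D : Type u₂} [Category.{v₂} D]
    (e : C ≌ D) (S : LocalStateClassifier D) : Nonempty (LocalStateClassifier C) := by
  refine nonempty_of_universal (e.inverse.obj S.Ξ)
    (fun X => e.unit.app X ≫ e.inverse.map (S.ξ (e.functor.obj X))) (fun {X Y} m _ => ?_)
    (fun {Z} ψ hψ => ?_) (fun {Z f g} h => ?_)
  · rw [← S.ξ_mono (e.functor.map m), Functor.map_comp, ← Category.assoc, ← Category.assoc]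
    exact congrArg (· ≫ _) (e.unit.naturality m)
  · obtain ⟨d, hd⟩ := S.exists_desc (fun Y => e.counitInv.app Y ≫ e.functor.map (ψ (e.inverse.obj Y)))
      fun {X Y} m _ => by
        have h := e.counitInv.naturality m
        dsimp at h
        rw [← hψ (e.inverse.map m), Functor.map_comp, ← Category.assoc, ← Category.assoc, h]
    refine ⟨e.inverse.map d ≫ e.unitInv.app Z, fun X => ?_⟩
    -- All factors are isomorphisms, so `k` is monic and the compatible family `ψ` absorbs it.
    let k : X ⟶ e.inverse.obj (e.functor.obj X) :=
      e.unit.app X ≫ e.inverse.map (e.counitInv.app (e.functor.obj X)) ≫ e.unitInv.app _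
    rw [Category.assoc, ← Functor.map_comp_assoc, hd, Functor.map_comp, Category.assoc,
      ← hψ k]
    simp [k]
  · apply e.functor.map_injective
    rw [← cancel_epi (e.counitInv.app S.Ξ)]
    refine S.ξ_hom_ext fun Y => ?_
    have hY : e.inverse.map (S.ξ Y) ≫ f = e.inverse.map (S.ξ Y) ≫ g := by
      have h := h (e.inverse.obj Y)
      have hm : e.counit.app Y ≫ S.ξ Y = S.ξ (e.functor.obj (e.inverse.obj Y)) :=
        S.ξ_mono (e.counit.app Y)
      rwa [← hm, Functor.map_comp, e.unit_inverse_comp_assoc] at h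
    have hn : S.ξ Y ≫ e.counitInv.app S.Ξ =
        e.counitInv.app Y ≫ e.functor.map (e.inverse.map (S.ξ Y)) := e.counitInv.naturality _
    rw [← Category.assoc, ← Category.assoc, hn, Category.assoc, Category.assoc]
    exact congrArg (_ ≫ ·) (by simpa using congrArg e.functor.map hY)

end LocalStateClassifier

/-! ### Sheaves on a small site: kernel pairs of sections -/

section Sheaf

variable {D : Type w} [SmallCategory D]

/-- The kernel pair of the map `よ(c) ⟶ X` given by a section `x` of `X` over `c`. -/
def kernelRel (X : Dᵒᵖ ⥤ Type w) {c : D} (x : X.obj (.op c)) (d : D) (f g : d ⟶ c) : Prop :=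
  X.map f.op x = X.map g.op x

variable (J : GrothendieckTopology D)

/-- The relations on representable presheaves that are kernel pairs of sections of sheaves. -/
def kernelRelPresheaf : Dᵒᵖ ⥤ Type w where
  -- Relations on the hom-sets of the small category `D` form a `Type w`, although the sheaves
  -- realizing them range over a larger universe.
  obj c := {R : ∀ d : D, (d ⟶ c.unop) → (d ⟶ c.unop) → Prop //
    ∃ (X : Sheaf J (Type w)) (x : X.obj.obj (.op c.unop)), R = kernelRel X.obj x}
  map {c c'} h := TypeCat.ofHom fun R => ⟨fun d f g => R.1 d (f ≫ h.unop) (g ≫ h.unop), by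
    obtain ⟨_, X, x, rfl⟩ := R
    refine ⟨X, X.obj.map h x, ?_⟩
    funext d f g
    simp [kernelRel]⟩
  map_id c := by
    ext R
    simp
  map_comp h h' := by
    ext R
    simp

/-- The map sending a section to its kernel pair. -/
def toKernelRelPresheaf (X : Sheaf J (Type w)) : X.obj ⟶ kernelRelPresheaf J where
  app c := TypeCat.ofHom fun x => ⟨kernelRel X.obj (c := c.unop) x, X, x, rfl⟩
  naturality c c' h := by
    ext x
    refine Subtype.ext ?_
    funext d f g
    simp [kernelRel, kernelRelPresheaf]

/-- The quotient of a representable presheaf by the kernel pair of a section. -/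
def kernelQuotient (X : Dᵒᵖ ⥤ Type w) {c : D} (x : X.obj (.op c)) : Dᵒᵖ ⥤ Type w where
  obj d := Quot (kernelRel X x d.unop)
  map h := TypeCat.ofHom (Quot.map (fun f => h.unop ≫ f) fun f g hfg => by
    simpa [kernelRel] using congrArg (X.map h) hfg)
  map_id d := by
    ext ⟨f⟩
    exact congrArg (Quot.mk _) (Category.id_comp f)
  map_comp h h' := by
    ext ⟨f⟩
    exact congrArg (Quot.mk _) (Category.assoc h'.unop h.unop f)

/-- A section with the same kernel pair induces a map from the quotient. -/
def kernelQuotientLift {X Y : Dᵒᵖ ⥤ Type w} {c : D} (x : X.obj (.op c)) (y : Y.obj (.op c))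
    (h : kernelRel X x = kernelRel Y y) : kernelQuotient X x ⟶ Y where
  app d := TypeCat.ofHom (Quot.lift (fun f => Y.map f.op y) fun f g hfg => by
    rw [h] at hfg
    exact hfg)
  naturality d d' k := by
    ext ⟨f⟩
    change Y.map (f.op ≫ k) y = Y.map k (Y.map f.op y)
    rw [Functor.map_comp]
    rfl

theorem mono_kernelQuotientLift {X Y : Dᵒᵖ ⥤ Type w} {c : D} (x : X.obj (.op c))
    (y : Y.obj (.op c)) (h : kernelRel X x = kernelRel Y y) : Mono (kernelQuotientLift x y h) := by
  rw [NatTrans.mono_iff_mono_app]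
  intro d
  rw [mono_iff_injective]
  rintro ⟨f⟩ ⟨g⟩ hfg
  refine Quot.sound ?_
  rw [h]
  exact hfg

theorem kernelQuotientLift_app {X Y : Dᵒᵖ ⥤ Type w} {c : D} (x : X.obj (.op c))
    (y : Y.obj (.op c)) (h : kernelRel X x = kernelRel Y y) :
    (kernelQuotientLift x y h).app (.op c) (Quot.mk _ (𝟙 c)) = y := by
  change Y.map (𝟙 (.op c)) y = y
  rw [CategoryTheory.Functor.map_id]
  rfl

/-- Sheafification preserves monomorphisms, so a subpresheaf of a sheaf extends to a monomorphism
from its sheafification. Hence `ψ X` restricted to `I` depends only on `I`. -/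
theorem apply_eq_apply_toSheafify {Z : Sheaf J (Type w)} (ψ : ∀ X : Sheaf J (Type w), X ⟶ Z)
    (hψ : ∀ {X Y : Sheaf J (Type w)} (m : X ⟶ Y) [Mono m], m ≫ ψ Y = ψ X)
    {I : Dᵒᵖ ⥤ Type w} {X : Sheaf J (Type w)} (j : I ⟶ X.obj) [Mono j] :
    j ≫ (ψ X).hom = toSheafify J I ≫ (ψ ((presheafToSheaf J _).obj I)).hom := by
  let adj := sheafificationAdjunction J (Type w)
  let j' : (presheafToSheaf J _).obj I ⟶ X := (adj.homEquiv I X).symm j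
  have hj' : j' = (presheafToSheaf J _).map j ≫ adj.counit.app X := adj.homEquiv_counit _ _ _
  have : Mono j' := by
    rw [hj']
    infer_instance
  have h : toSheafify J I ≫ j'.hom = j :=
    (adj.homEquiv_unit _ _ j').symm.trans ((adj.homEquiv I X).apply_symm_apply j)
  rw [← hψ j', ← h, Category.assoc]
  rfl

/-- The quotient of the representable by the common kernel pair embeds in both `X` and `Y`, and the
class of the identity goes to `x` and to `y`. -/
theorem apply_eq_apply_of_kernelRel_eq {Z : Sheaf J (Type w)}
    (ψ : ∀ X : Sheaf J (Type w), X ⟶ Z)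
    (hψ : ∀ {X Y : Sheaf J (Type w)} (m : X ⟶ Y) [Mono m], m ≫ ψ Y = ψ X)
    {X Y : Sheaf J (Type w)} {c : D} (x : X.obj.obj (.op c)) (y : Y.obj.obj (.op c))
    (h : kernelRel X.obj x = kernelRel Y.obj y) :
    (ψ X).hom.app (.op c) x = (ψ Y).hom.app (.op c) y := by
  have := mono_kernelQuotientLift x x rfl
  have := mono_kernelQuotientLift x y h
  have hx := apply_eq_apply_toSheafify J ψ hψ (kernelQuotientLift x x rfl)
  have hy := apply_eq_apply_toSheafify J ψ hψ (kernelQuotientLift x y h)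
  rw [← kernelQuotientLift_app x y h]
  conv_lhs => rw [← kernelQuotientLift_app x x rfl]
  exact congrArg (fun k => k.app (.op c) (Quot.mk _ (𝟙 c))) (hx.trans hy.symm)

theorem exists_kernelRelPresheaf_desc {Z : Sheaf J (Type w)}
    (ψ : ∀ X : Sheaf J (Type w), X ⟶ Z)
    (hψ : ∀ {X Y : Sheaf J (Type w)} (m : X ⟶ Y) [Mono m], m ≫ ψ Y = ψ X) :
    ∃ δ : kernelRelPresheaf J ⟶ Z.obj, ∀ X, toKernelRelPresheaf J X ≫ δ = (ψ X).hom := by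
  have key (c : Dᵒᵖ) (R : (kernelRelPresheaf J).obj c) : ∃ z : Z.obj.obj c,
      ∀ (X : Sheaf J (Type w)) (x : X.obj.obj c),
        (toKernelRelPresheaf J X).app c x = R → (ψ X).hom.app c x = z := by
    obtain ⟨_, X, x, rfl⟩ := R
    exact ⟨(ψ X).hom.app c x, fun Y y h =>
      apply_eq_apply_of_kernelRel_eq J ψ hψ (c := c.unop) y x (congrArg Subtype.val h)⟩
  choose z hz using key
  refine ⟨{ app := fun c => TypeCat.ofHom (z c), naturality := fun c c' h => ?_ }, fun X => ?_⟩
  · ext R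
    obtain ⟨X, x, hR⟩ := R.2
    have hx : (toKernelRelPresheaf J X).app c x = R := Subtype.ext hR.symm
    have h1 := hz c R X x hx
    have h2 := hz c' ((kernelRelPresheaf J).map h R) X (X.obj.map h x) (by
      rw [← hx]
      exact NatTrans.naturality_apply _ _ _)
    have h3 := NatTrans.naturality_apply (ψ X).hom h x
    rw [h1, h2] at h3
    exact h3
  · ext c x
    exact (hz c _ X x rfl).symm

theorem nonempty_localStateClassifier_sheaf :
    Nonempty (LocalStateClassifier (Sheaf J (Type w))) := by
  let K := kernelRelPresheaf J
  let adj := sheafificationAdjunction J (Type w)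
  refine LocalStateClassifier.nonempty_of_universal ((presheafToSheaf J _).obj K)
    (fun X => ObjectProperty.homMk (toKernelRelPresheaf J X ≫ toSheafify J K)) (fun {X Y} m _ => ?_)
    (fun {Z} ψ hψ => ?_) (fun {Z f g} h => ?_)
  · ext1
    change m.hom ≫ toKernelRelPresheaf J Y ≫ toSheafify J K = toKernelRelPresheaf J X ≫ toSheafify J K
    rw [← Category.assoc]
    congr 1
    ext c x
    refine Subtype.ext ?_
    funext d k l
    -- A monomorphism of sheaves is injective on sections, so it leaves kernel pairs unchanged.
    have hm : Function.Injective (m.hom.app (.op d)) := by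
      rw [← mono_iff_injective]
      infer_instance
    change (Y.obj.map k.op (m.hom.app c x) = Y.obj.map l.op (m.hom.app c x)) = (_ = _)
    rw [← NatTrans.naturality_apply, ← NatTrans.naturality_apply, hm.eq_iff]
  · obtain ⟨δ, hδ⟩ := exists_kernelRelPresheaf_desc J ψ hψ
    refine ⟨(adj.homEquiv K Z).symm δ, fun X => ?_⟩
    ext1
    have h : toSheafify J K ≫ ((adj.homEquiv K Z).symm δ).hom = δ :=
      (adj.homEquiv_unit _ _ _).symm.trans ((adj.homEquiv K Z).apply_symm_apply δ)
    exact (Category.assoc _ _ _).trans ((congrArg (_ ≫ ·) h).trans (hδ X))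
  · apply (adj.homEquiv K Z).injective
    ext c R
    -- Every element of `K` is the kernel pair of a section, so the maps from sheaves to `K` are
    -- jointly surjective.
    obtain ⟨_, X, x, rfl⟩ := R
    rw [adj.homEquiv_unit, adj.homEquiv_unit]
    exact congrArg (fun k => k.hom.app c x) (h X)

end Sheaf

theorem IsGrothendieckTopos.nonempty_localStateClassifier {C : Type u} [Category.{v} C]
    (h : IsGrothendieckTopos.{w} C) : Nonempty (LocalStateClassifier C) := by
  obtain ⟨D, _, J, ⟨e⟩⟩ := h
  obtain ⟨S⟩ := nonempty_localStateClassifier_sheaf J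
  exact S.nonempty_of_equivalence e

end LSC

theorem theorem4p1 {E : Type u} [Category.{v} E] [CartesianMonoidalCategory E]
    [LSC.ElementaryTopos E] :
    (LSC.IsGrothendieckTopos.{w} E → Nonempty (LSC.LocalStateClassifier E)) ∧
    ∀ (S : LSC.LocalStateClassifier E) (c : Subobject.Classifier E),
      ∃ (Φ : LSC.HyperconnectedQuotient E ≃ LSC.InternalFilter S.semilattice)
        (Ψ : LSC.InternalFilter S.semilattice ≃
          LSC.SemilatticeHom S.semilattice (LSC.omegaSemilattice c)),
        (∀ F : LSC.InternalFilter S.semilattice, (Ψ F).hom = c.χ F.sub.arrow) ∧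
        ∀ Q : LSC.HyperconnectedFrom E,
          (∀ X : E, Q.inverseImage.essImage X ↔ (Φ Q.toQuotient).sub.Factors (S.ξ X)) ∧
          ∀ X : E, ∃ p, IsPullback (Q.counit X) p (S.ξ X) (Φ Q.toQuotient).sub.arrow :=
  ⟨fun h => h.nonempty_localStateClassifier, fun S c =>
    ⟨LSC.quotientEquivFilter S c, LSC.filterEquivHom c, fun _ => rfl, fun Q =>
      ⟨Q.essImage_iff_factors_toFilter S c, Q.exists_isPullback_counit S c⟩⟩⟩
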